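/- Let $\mathcal A$ be a finite alphabet, let $(a_k)_{k\ge 0}$ be letters of $\mathcal A$ with $a_k\neq a_{k+1}$ for all $k$, and let $n_k\ge 2$ and $0\le r_k<n_k$ be integers for $k\ge 0$. Let $\omega_k$ be the two-sided word with holes obtained by successively filling: $\omega_0=(a_0^{n_0-1}?)^\infty$ is the $n_0$-periodic word with holes exactly at $n_0\mathbb Z+r_0$ and the letter $a_0$ elsewhere; $\omega_{k+1}$ arises from $\omega_k$ by filling the word $(a_{k+1}^{n_{k+1}-1}?)^\infty$ (holes at $n_{k+1}\mathbb Z+r_{k+1}$) into its holes, in order, with the letter at position $0$ put into the first hole of $\omega_k$ at a non-negative position. Let $\omega_\infty=\lim_k\omega_k$. It has at most one hole; if there is one, fill it with any letter that occurs infinitely often in $(a_k)$. The resulting word $\omega\in\mathcal A^{\mathbb Z}$ is required not to be periodic; it is called a simple Toeplitz word. Let $\Omega$ be the simple Toeplitz subshift generated by $\omega$, i.e. the closure of $\{T^k\omega:k\in\mathbb N\}$ in $\mathcal A^{\mathbb Z}$ (product of the discrete topologies), where $(T\alpha)(j)=\alpha(j+1)$. The subshift $\Omega$ satisfies the Boshernitzan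 condition (B) if it has a unique $T$-invariant Borel probability measure $\nu$ (which is always the case for a simple Toeplitz subshift) and $$\limsup_{L\to\infty} L\cdot\eta(L)>0,\qquad \eta(L):=\min\{\nu([u]_1): u \text{ a word of length } L \text{ occurring in an element of } \Omega\},$$ where $[u]_1$ is the set of those $\alpha\in\mathcal A^{\mathbb Z}$ in which $u$ occurs at position $1$. For $k\ge 0$ let $K(k):=\min\{j>k:\{a_{k+1},\dots,a_j\}=\{a_i: i\ge k+1\}\}$. Define $m_0:=0$ and let $m_{i+1}$ be the smallest $j>m_i$ with $K(j)>K(m_i)$, so that $K(m_i)=K(m_i+1)=\dots=K(m_{i+1}-1)<K(m_{i+1})$. Empty products are $1$. Then the following are equivalent: 1. $\Omega$ satisfies (B); 2. there is a sequence $(k_t)_{t\ge 1}$ of positive integers with $\lim_{t\to\infty}k_t=\infty$ such that $\prod_{j=k_t+1}^{K(k_t-1)-1}n_j$ is bounded in $t$; 3. there is a subsequence $(m_{i_t})_{t\ge 1}$ of $(m_i)_{i\ge 1}$ such that $\prod_{j=m_{i_t}+1}^{K(m_{i_t}-1)-1}n_j$ is bounded in $t$. -/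

import Mathlib

open Filter MeasureTheory
open scoped ENNReal

namespace SimpleToeplitz

variable {A : Type*}

/-! Words with holes: a letter is `some c`, a hole is `none`. -/

/-- The two-sided periodic word `(c^{p-1}?)^∞` with period `p` and undetermined part `pℤ + q`. -/
def holeWord (c : A) (p q : ℕ) (j : ℤ) : Option A :=
  if (p : ℤ) ∣ j - q then none else some c

/-- The filling of `β` into the holes of `α`, where `pℤ + q` is the set of holes of `α`: the hole at
position `p * i + q` receives `β i`. -/
def fill (p q : ℕ) (α β : ℤ → Option A) (j : ℤ) : Option A :=
  if (p : ℤ) ∣ j - q then β ((j - q) / p) else α j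

/-- `s_k = n_0 ⋯ n_{k-1}`. -/
def periodProd (n : ℕ → ℕ) (k : ℕ) : ℕ := ∏ i ∈ Finset.range k, n i

/-- `r_0 + r_1 n_0 + ⋯ + r_{k-1} n_0 ⋯ n_{k-2}`. -/
def holeOffset (n r : ℕ → ℕ) (k : ℕ) : ℕ := ∑ i ∈ Finset.range k, r i * periodProd n i

/-- `ω_k = (a_0^{n_0-1}?)^∞ ◁ ⋯ ◁ (a_k^{n_k-1}?)^∞`. The holes of `ω_k` are the positions in
`s_{k+1} ℤ + holeOffset (k+1)`, see `partialWord_eq_none_iff`. -/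
def partialWord (a : ℕ → A) (n r : ℕ → ℕ) : ℕ → ℤ → Option A
  | 0 => holeWord (a 0) (n 0) (r 0)
  | k + 1 => fill (periodProd n (k + 1)) (holeOffset n r (k + 1))
      (partialWord a n r k) (holeWord (a (k + 1)) (n (k + 1)) (r (k + 1)))

/-- `ω_k` has exactly the holes `n_0 ⋯ n_k ℤ + (r_0 + ∑_{j=1}^k r_j n_0 ⋯ n_{j-1})`. -/
theorem partialWord_eq_none_iff (a : ℕ → A) (n r : ℕ → ℕ) (hn : ∀ k, 2 ≤ n k) (k : ℕ) (j : ℤ) :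
    partialWord a n r k j = none ↔
      (periodProd n (k + 1) : ℤ) ∣ j - holeOffset n r (k + 1) := by
  induction k with
  | zero => simp [partialWord, holeWord, periodProd, holeOffset]
  | succ k ih =>
    have hpos : (periodProd n (k + 1) : ℤ) ≠ 0 := by
      have : periodProd n (k + 1) ≠ 0 :=
        Finset.prod_ne_zero_iff.mpr fun i _ => by have := hn i; omega
      exact_mod_cast this
    have hs : (periodProd n (k + 2) : ℤ) = periodProd n (k + 1) * n (k + 1) := by
      simp [periodProd, Finset.prod_range_succ]
    have ho : (holeOffset n r (k + 2) : ℤ) =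
        holeOffset n r (k + 1) + r (k + 1) * periodProd n (k + 1) := by
      simp [holeOffset, Finset.sum_range_succ]
    rw [partialWord, fill, hs, ho]
    by_cases h : (periodProd n (k + 1) : ℤ) ∣ j - holeOffset n r (k + 1)
    · rw [if_pos h]
      obtain ⟨t, ht⟩ := h
      have e : j - (holeOffset n r (k + 1) + (r (k + 1) : ℤ) * periodProd n (k + 1)) =
          periodProd n (k + 1) * (t - r (k + 1)) := by linear_combination ht
      rw [e, ht, Int.mul_ediv_cancel_left _ hpos, mul_dvd_mul_iff_left hpos]
      simp [holeWord]
    · rw [if_neg h, ih]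
      refine ⟨fun h' => absurd h' h, fun h' => absurd ?_ h⟩
      obtain ⟨t, ht⟩ := h'
      exact ⟨n (k + 1) * t + r (k + 1), by linear_combination ht⟩

open Classical in
/-- The limit `ω_∞` of the words `ω_k`: a position that is filled at some stage keeps its letter
ever after, a position that is never filled remains a hole. -/
noncomputable def limitWord (a : ℕ → A) (n r : ℕ → ℕ) (j : ℤ) : Option A :=
  if h : ∃ k, partialWord a n r k j ≠ none then partialWord a n r (Nat.find h) j else none

/-- `A_k = {a_j : j ≥ k}`. -/
def tailAlphabet (a : ℕ → A) (k : ℕ) : Set A := a '' Set.Ici k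

/-- The eventual alphabet `⋂_k A_k`. -/
def eventualAlphabet (a : ℕ → A) : Set A := ⋂ k, tailAlphabet a k

/-- `ω` is a (normal or extended) simple Toeplitz word with coding sequences `a`, `n`, `r`: it is
not periodic and it is obtained from `ω_∞` by inserting a letter of the eventual alphabet into the
undetermined position, if there is one. -/
structure IsSimpleToeplitzWord (a : ℕ → A) (n r : ℕ → ℕ) (ω : ℤ → A) : Prop where
  two_le : ∀ k, 2 ≤ n k
  lt_period : ∀ k, r k < n k
  letter_ne : ∀ k, a k ≠ a (k + 1)
  eq_limit : ∃ c ∈ eventualAlphabet a, ∀ j, ω j = (limitWord a n r j).getD c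
  not_periodic : ¬ ∃ p : ℤ, 0 < p ∧ ∀ j, ω (j + p) = ω j

/-- The left shift on two-sided infinite words. -/
def shift (α : ℤ → A) : ℤ → A := fun j => α (j + 1)

/-- The subshift of `ω`, the closure of its orbit under the shift in the product topology. -/
def subshiftOf [TopologicalSpace A] (ω : ℤ → A) : Set (ℤ → A) :=
  closure {α | ∃ k : ℕ, 1 ≤ k ∧ α = shift^[k] ω}

/-- The cylinder set `[u]_j` of the words in which the finite word `u` occurs at position `j`. -/
def cyl {L : ℕ} (u : Fin L → A) (j : ℤ) : Set (ℤ → A) :=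
  {α | ∀ i : Fin L, α (j + (i : ℕ)) = u i}

/-- The words of length `L` that occur in elements of `X`. -/
def words (X : Set (ℤ → A)) (L : ℕ) : Set (Fin L → A) :=
  {u | ∃ α ∈ X, ∃ j : ℤ, α ∈ cyl u j}

/-- `ν` is a shift-invariant Borel probability measure on `X`, viewed as a measure on `A^ℤ`. -/
structure IsInvariantProb [MeasurableSpace A] (X : Set (ℤ → A)) (ν : Measure (ℤ → A)) : Prop where
  prob : IsProbabilityMeasure ν
  support : ν Xᶜ = 0
  invariant : MeasurePreserving shift ν ν

/-- `η(L)`, the minimum of `ν([u]_1)` over the words `u` of length `L` of `X`. -/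
noncomputable def minFreq [MeasurableSpace A] (X : Set (ℤ → A)) (ν : Measure (ℤ → A)) (L : ℕ) :
    ℝ≥0∞ :=
  ⨅ u ∈ words X L, ν (cyl u 1)

/-- The Boshernitzan condition for a uniquely ergodic subshift `X`: the unique invariant probability
measure `ν` on `X` satisfies `limsup L · η(L) > 0`. -/
def Boshernitzan [MeasurableSpace A] (X : Set (ℤ → A)) : Prop :=
  ∃ ν : Measure (ℤ → A), IsInvariantProb X ν ∧ (∀ ν', IsInvariantProb X ν' → ν' = ν) ∧
    0 < limsup (fun L : ℕ => (L : ℝ≥0∞) * minFreq X ν L) atTop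

/-- `K(k) = min {j > k : {a_{k+1}, …, a_j} = A_{k+1}}`. -/
noncomputable def allLetters (a : ℕ → A) (k : ℕ) : ℕ :=
  sInf {j | k < j ∧ a '' Set.Icc (k + 1) j = tailAlphabet a (k + 1)}

/-- The positions `m_i` at which `K` grows: `m_0 = 0` and
`K(m_i) = ⋯ = K(m_{i+1} - 1) < K(m_{i+1})`. -/
noncomputable def growthPos (a : ℕ → A) : ℕ → ℕ
  | 0 => 0
  | i + 1 => sInf {j | growthPos a i < j ∧ allLetters a (growthPos a i) < allLetters a j}

/-- `∏_{j=k+1}^{K(k-1)-1} n_j`, for `k ≥ 1`. -/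
noncomputable def gapProd (a : ℕ → A) (n : ℕ → ℕ) (k : ℕ) : ℕ :=
  ∏ j ∈ Finset.Ico (k + 1) (allLetters a (k - 1)), n j

end SimpleToeplitz

/-!
Write `s_k = n_0 ⋯ n_{k-1}`. The positions that are still holes before stage `k` (`IsHole n r k`)
form a residue class modulo `s_k`; those filled at stage `k` carry `a_k`, those left open carry a
letter of `A_{k+1} = {a_j : j > k}`, and outside this class `ω` is `s_k`-periodic. So `ω` is a
concatenation of copies of one block `p_k` of length `s_k - 1`, separated by single letters of
`A_k`. The proof uses only these facts (`apply_eq`, `apply_mem_tailAlphabet`, `apply_add_eq`).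

Unique ergodicity. The measure of a pattern under an invariant measure is the mean number of its
occurrences in a window. In a window of length `s_k` this number is determined up to the size of
the pattern, because only occurrences that meet a hole of level `k` depend on the window
(`countOcc_periodProd`); dividing by `s_k → ∞` gives uniqueness. Existence is the
Krylov–Bogoliubov argument.

Put `K = K(k - 1)`, so that `{a_k, …, a_K} = A_k` and `a_K` is not among `a_k, …, a_{K-1}`, and
the product in question is `s_K / s_{k+1}` (`periodProd_mul_gapProd`).

If these products are bounded along a sequence, take `L = (n_k - 1) s_k ≥ s_{k+1} / 2`. A word of
length `L` meets at most one hole of level `k + 1`. If the letter there is `a_i` with `k < i ≤ K`,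
the word reappears around every position filled at stage `i`. If it is `a_k`, the word is
`s_k`-periodic and, by the choice of `L`, short enough to reappear inside `p_{k+1}`. In all cases
it occurs in every window of length `2 s_K` (`exists_patternSet_mem_window`), so `L · η(L) ≥
s_{k+1} / (4 s_K)`.

Conversely, the word `p_k a_K p_k` can occur in `ω` only around holes of level `K`
(`isHole_of_forall_eq`), so that any longer word containing it has measure at most `1 / s_K`.
Choosing `k` with `2 s_k - 1 ≤ L < 2 s_{k+1} - 1` gives `L · η(L) ≤ 2 s_{k+1} / s_K`, which tends
to `0` if the products tend to infinity.

That only growth positions matter is `exists_gapProd_le_iff_growthPos`.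
-/

namespace SimpleToeplitz

variable {A : Type*}

/-! ### Invariant measures of a subshift and occurrences in the generating word -/

/-- The set of words that carry the letters `w i`, `i ∈ I`, at the positions `j + i`. Unlike a
cylinder set, it allows gaps between the prescribed positions. -/
def patternSet (I : Finset ℤ) (w : ℤ → A) (j : ℤ) : Set (ℤ → A) :=
  {α | ∀ i ∈ I, α (j + i) = w i}

lemma mem_patternSet {I : Finset ℤ} {w : ℤ → A} {j : ℤ} {α : ℤ → A} :
    α ∈ patternSet I w j ↔ ∀ i ∈ I, α (j + i) = w i := Iff.rfl

lemma cyl_eq_patternSet {L : ℕ} {u : Fin L → A} {ω : ℤ → A} {q : ℤ} (h : ω ∈ cyl u q) (j : ℤ) :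
    cyl u j = patternSet (Finset.Ico 0 (L : ℤ)) (fun i => ω (q + i)) j := by
  ext α
  constructor
  · intro hα i hi
    rw [Finset.mem_Ico] at hi
    lift i to ℕ using hi.1
    have hi' : i < L := by exact_mod_cast hi.2
    exact (hα ⟨i, hi'⟩).trans (h ⟨i, hi'⟩).symm
  · intro hα i
    exact (hα (i : ℕ) (by simp)).trans (h i)

lemma shift_iterate_apply (k : ℕ) (α : ℤ → A) (j : ℤ) : shift^[k] α j = α (j + k) := by
  induction k generalizing j with
  | zero => simp
  | succ k ih =>
    rw [Function.iterate_succ_apply', shift, ih]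
    push_cast
    ring_nf

lemma shift_preimage_patternSet (I : Finset ℤ) (w : ℤ → A) (j : ℤ) :
    shift ⁻¹' patternSet I w j = patternSet I w (j + 1) := by
  ext α
  simp only [Set.mem_preimage, mem_patternSet, shift]
  refine forall₂_congr fun i _ => ?_
  rw [show j + i + 1 = j + 1 + i by ring]

open Classical in
/-- The number of occurrences of a pattern in `α` at the positions `q, …, q + N - 1`. -/
noncomputable def countOcc (α : ℤ → A) (I : Finset ℤ) (w : ℤ → A) (N : ℕ) (q : ℤ) : ℕ :=
  ((Finset.range N).filter fun m : ℕ => α ∈ patternSet I w (q + m)).card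

section Topology

variable [TopologicalSpace A]

lemma isClopen_patternSet [DiscreteTopology A] (I : Finset ℤ) (w : ℤ → A) (j : ℤ) :
    IsClopen (patternSet I w j) := by
  have : patternSet I w j = ⋂ i ∈ I, (fun α : ℤ → A => α (j + i)) ⁻¹' {w i} := by
    ext α
    simp [mem_patternSet]
  rw [this]
  exact isClopen_biInter_finset fun i _ => (isClopen_discrete _).preimage (continuous_apply _)

lemma continuous_shift : Continuous (shift : (ℤ → A) → ℤ → A) :=
  continuous_pi fun _ => continuous_apply _

lemma shift_iterate_mem_subshiftOf (ω : ℤ → A) (k : ℕ) : shift^[k + 1] ω ∈ subshiftOf ω :=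
  subset_closure ⟨k + 1, by omega, rfl⟩

lemma exists_forall_eq_translate [DiscreteTopology A] {ω α : ℤ → A} (hα : α ∈ subshiftOf ω)
    (F : Finset ℤ) : ∃ k : ℤ, ∀ j ∈ F, ω (k + j) = α j := by
  obtain ⟨β, hβ, k, -, rfl⟩ := mem_closure_iff.1 hα (patternSet F α 0)
    (isClopen_patternSet F α 0).isOpen (by simp [mem_patternSet])
  refine ⟨k, fun j hj => ?_⟩
  have := hβ j hj
  rwa [shift_iterate_apply, zero_add, add_comm] at this

/-- A word of the subshift shows on every window the same occurrences as the generating word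
does on some other window. -/
lemma exists_countOcc_eq [DiscreteTopology A] {ω α : ℤ → A} (hα : α ∈ subshiftOf ω)
    (I : Finset ℤ) (w : ℤ → A) (N : ℕ) : ∃ q, countOcc α I w N 0 = countOcc ω I w N q := by
  classical
  obtain ⟨k, hk⟩ := exists_forall_eq_translate hα
    ((Finset.range N ×ˢ I).image fun p => (p.1 : ℤ) + p.2)
  refine ⟨k, ?_⟩
  unfold countOcc
  congr 1
  refine Finset.filter_congr fun m hm => ?_
  rw [mem_patternSet, mem_patternSet]
  refine forall₂_congr fun i hi => ?_
  rw [← hk (0 + m + i) (Finset.mem_image.2 ⟨(m, i), Finset.mk_mem_product hm hi, by simp⟩)]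
  ring_nf

lemma mem_words_subshiftOf_iff [DiscreteTopology A] {ω : ℤ → A} {L : ℕ} {u : Fin L → A} :
    u ∈ words (subshiftOf ω) L ↔ ∃ q, ω ∈ cyl u q := by
  constructor
  · rintro ⟨α, hα, j, hj⟩
    obtain ⟨k, hk⟩ := exists_forall_eq_translate hα
      (Finset.univ.image fun i : Fin L => j + (i : ℕ))
    refine ⟨k + j, fun i => ?_⟩
    rw [add_assoc, hk _ (Finset.mem_image_of_mem _ (Finset.mem_univ i)), hj i]
  · rintro ⟨q, hq⟩
    refine ⟨_, shift_iterate_mem_subshiftOf ω 0, q - 1, fun i => ?_⟩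
    rw [shift_iterate_apply, ← hq i]
    push_cast
    ring_nf

end Topology

section Measure

variable [TopologicalSpace A] [DiscreteTopology A] [MeasurableSpace A] [BorelSpace A]

variable [Finite A]

lemma measurableSet_patternSet (I : Finset ℤ) (w : ℤ → A) (j : ℤ) :
    MeasurableSet (patternSet I w j) :=
  (isClopen_patternSet I w j).isOpen.measurableSet

lemma measure_patternSet_eq {X : Set (ℤ → A)} {ν : Measure (ℤ → A)} (hν : IsInvariantProb X ν)
    (I : Finset ℤ) (w : ℤ → A) (j : ℤ) : ν (patternSet I w j) = ν (patternSet I w 0) := by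
  have step : ∀ i : ℤ, ν (patternSet I w (i + 1)) = ν (patternSet I w i) := fun i => by
    rw [← shift_preimage_patternSet,
      hν.invariant.measure_preimage (measurableSet_patternSet I w i).nullMeasurableSet]
  induction j using Int.induction_on with
  | zero => rfl
  | succ i ih => rw [step, ih]
  | pred i ih => rw [← ih, ← step, sub_add_cancel]

/-- The measure of a pattern is its mean number of occurrences in a window. -/
lemma lintegral_countOcc {X : Set (ℤ → A)} {ν : Measure (ℤ → A)} (hν : IsInvariantProb X ν)
    (I : Finset ℤ) (w : ℤ → A) (N : ℕ) :
    ∫⁻ α, (countOcc α I w N 0 : ℝ≥0∞) ∂ν = N * ν (patternSet I w 0) := by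
  have h : ∀ α : ℤ → A, (countOcc α I w N 0 : ℝ≥0∞) =
      ∑ m ∈ Finset.range N, (patternSet I w (0 + m)).indicator 1 α := fun α => by
    classical
    simp [countOcc, Set.indicator_apply]
  simp_rw [h]
  rw [lintegral_finsetSum _ fun m _ =>
    measurable_one.indicator (measurableSet_patternSet I w _)]
  simp_rw [lintegral_indicator_one (measurableSet_patternSet I w _), measure_patternSet_eq hν]
  simp

lemma le_mul_measure_patternSet {ω : ℤ → A} {ν : Measure (ℤ → A)}
    (hν : IsInvariantProb (subshiftOf ω) ν) {I : Finset ℤ} {w : ℤ → A} {N c : ℕ}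
    (h : ∀ q, c ≤ countOcc ω I w N q) : (c : ℝ≥0∞) ≤ N * ν (patternSet I w 0) := by
  have := hν.prob
  rw [← lintegral_countOcc hν]
  calc (c : ℝ≥0∞) = ∫⁻ _, (c : ℝ≥0∞) ∂ν := by simp
    _ ≤ _ := lintegral_mono_ae ?_
  filter_upwards [measure_eq_zero_iff_ae_notMem.1 hν.support] with α hα
  obtain ⟨q, hq⟩ := exists_countOcc_eq (not_not.1 hα) I w N
  rw [hq]
  exact_mod_cast h q

lemma mul_measure_patternSet_le {ω : ℤ → A} {ν : Measure (ℤ → A)}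
    (hν : IsInvariantProb (subshiftOf ω) ν) {I : Finset ℤ} {w : ℤ → A} {N c : ℕ}
    (h : ∀ q, countOcc ω I w N q ≤ c) : N * ν (patternSet I w 0) ≤ (c : ℝ≥0∞) := by
  have := hν.prob
  rw [← lintegral_countOcc hν]
  calc _ ≤ ∫⁻ _, (c : ℝ≥0∞) ∂ν := lintegral_mono_ae ?_
    _ = (c : ℝ≥0∞) := by simp
  filter_upwards [measure_eq_zero_iff_ae_notMem.1 hν.support] with α hα
  obtain ⟨q, hq⟩ := exists_countOcc_eq (not_not.1 hα) I w N
  rw [hq]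
  exact_mod_cast h q

lemma measure_ext_of_patternSet {μ ν : Measure (ℤ → A)} [IsFiniteMeasure ν]
    (h : ∀ I w, μ (patternSet I w 0) = ν (patternSet I w 0)) : μ = ν := by
  classical
  have hμ : IsProjectiveLimit μ fun I : Finset ℤ => ν.map I.restrict := fun I => by
    refine Measure.ext_of_singleton fun x => ?_
    rcases isEmpty_or_nonempty A with hA | ⟨⟨c⟩⟩
    · have : IsEmpty (ℤ → A) := ⟨fun f => hA.false (f 0)⟩
      simp [Measure.eq_zero_of_isEmpty]
    have hx : (I.restrict : (ℤ → A) → I → A) ⁻¹' {x} =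
        patternSet I (fun i => if hi : i ∈ I then x ⟨i, hi⟩ else c) 0 := by
      ext α
      simp only [Set.mem_preimage, Set.mem_singleton_iff, mem_patternSet, funext_iff,
        Finset.restrict, zero_add, Subtype.forall]
      refine forall₂_congr fun i hi => ?_
      rw [dif_pos hi]
    rw [Measure.map_apply (Finset.measurable_restrict I) (measurableSet_singleton x),
      Measure.map_apply (Finset.measurable_restrict I) (measurableSet_singleton x), hx, h]
  exact hμ.unique fun I => rfl

/-- If, for each pattern, windows of arbitrarily large length contain the same number of
occurrences up to a bounded error, then there is at most one invariant measure. -/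
lemma IsInvariantProb.unique {ω : ℤ → A}
    (h : ∀ (I : Finset ℤ) (w : ℤ → A), ∃ C : ℕ, ∀ N₀ : ℕ, ∃ N ≥ N₀, ∃ c, ∀ q,
      c ≤ countOcc ω I w N q ∧ countOcc ω I w N q ≤ c + C)
    {μ ν : Measure (ℤ → A)} (hμ : IsInvariantProb (subshiftOf ω) μ)
    (hν : IsInvariantProb (subshiftOf ω) ν) : μ = ν := by
  have key : ∀ {μ ν : Measure (ℤ → A)}, IsInvariantProb (subshiftOf ω) μ →
      IsInvariantProb (subshiftOf ω) ν → ∀ I w, μ (patternSet I w 0) ≤ ν (patternSet I w 0) := by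
    intro μ ν hμ hν I w
    have := hν.prob
    obtain ⟨C, hC⟩ := h I w
    choose N hN c hc using hC
    have hle : ∀ n : ℕ, μ (patternSet I w 0) ≤ ν (patternSet I w 0) + C / (n + 1 : ℕ) := by
      intro n
      have hNpos : (N (n + 1) : ℝ≥0∞) ≠ 0 := by
        have := hN (n + 1)
        exact_mod_cast (by omega : N (n + 1) ≠ 0)
      have h1 := mul_measure_patternSet_le hμ fun q => (hc (n + 1) q).2
      have h2 := le_mul_measure_patternSet hν fun q => (hc (n + 1) q).1
      have h3 : N (n + 1) * μ (patternSet I w 0) ≤ N (n + 1) * ν (patternSet I w 0) + C :=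
        h1.trans (by push_cast; gcongr)
      have h4 : μ (patternSet I w 0) ≤ ν (patternSet I w 0) + C / N (n + 1) := by
        rw [← ENNReal.mul_le_mul_iff_right hNpos (ENNReal.natCast_ne_top _), mul_add,
          ENNReal.mul_div_cancel hNpos (ENNReal.natCast_ne_top _)]
        exact h3
      refine h4.trans ?_
      gcongr
      exact hN (n + 1)
    have hlim : Tendsto (fun n : ℕ => ν (patternSet I w 0) + (C : ℝ≥0∞) / (n + 1 : ℕ)) atTop
        (nhds (ν (patternSet I w 0) + 0)) := by
      refine Tendsto.const_add _ ?_
      have := (ENNReal.Tendsto.const_div ENNReal.tendsto_nat_nhds_top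
        (Or.inr (ENNReal.natCast_ne_top C))).comp (tendsto_add_atTop_nat 1)
      simpa [Function.comp_def] using this
    simpa using ge_of_tendsto' hlim hle
  have := hν.prob
  exact measure_ext_of_patternSet fun I w => le_antisymm (key hμ hν I w) (key hν hμ I w)

/-- Krylov–Bogoliubov: a subshift carries an invariant probability measure, namely any weak limit
point of the empirical measures along the orbit of the generating word. -/
lemma exists_isInvariantProb (ω : ℤ → A) : ∃ ν, IsInvariantProb (subshiftOf ω) ν := by
  let μ : ℕ → Measure (ℤ → A) := fun N =>
    ((N + 1 : ℕ) : ℝ≥0∞)⁻¹ • ∑ m ∈ Finset.range (N + 1), Measure.dirac (shift^[m + 1] ω)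
  have hne : ∀ N : ℕ, ((N + 1 : ℕ) : ℝ≥0∞) ≠ 0 := fun N => by exact_mod_cast N.succ_ne_zero
  have hprob : ∀ N, IsProbabilityMeasure (μ N) := fun N => ⟨by
    simp only [μ, Measure.smul_apply, Measure.finsetSum_apply, measure_univ, Finset.sum_const,
      Finset.card_range, smul_eq_mul, nsmul_eq_mul, mul_one]
    exact ENNReal.inv_mul_cancel (hne N) (ENNReal.natCast_ne_top _)⟩
  let P : ℕ → ProbabilityMeasure (ℤ → A) := fun N => ⟨μ N, hprob N⟩
  obtain ⟨ν, -, hν⟩ := isCompact_univ.ultrafilter_le_nhds ((hyperfilter ℕ).map P) (by simp)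
  have hlim : Tendsto P (hyperfilter ℕ) (nhds ν) := hν
  have hle : (hyperfilter ℕ : Filter ℕ) ≤ atTop := by
    rw [← Nat.cofinite_eq_atTop]
    exact hyperfilter_le_cofinite
  have hpat : ∀ I w j, Tendsto (fun N => μ N (patternSet I w j)) (hyperfilter ℕ)
      (nhds ((ν : Measure (ℤ → A)) (patternSet I w j))) := fun I w j =>
    ProbabilityMeasure.tendsto_measure_of_null_frontier_of_tendsto' hlim
      (by rw [(isClopen_patternSet I w j).frontier_eq, measure_empty])
  -- Consecutive shifts of a pattern have almost the same empirical measure: the sums telescope.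
  have htel : ∀ I w N (i j : ℤ), (i = 0 ∧ j = 1) ∨ (i = 1 ∧ j = 0) →
      μ N (patternSet I w i) ≤ μ N (patternSet I w j) + ((N + 1 : ℕ) : ℝ≥0∞)⁻¹ := by
    intro I w N i j hij
    have hshift : ∀ m : ℕ, Measure.dirac (shift^[m + 1] ω) (patternSet I w 1) =
        Measure.dirac (shift^[m + 1 + 1] ω) (patternSet I w 0) := fun m => by
      rw [Measure.dirac_apply' _ (measurableSet_patternSet I w 1),
        Measure.dirac_apply' _ (measurableSet_patternSet I w 0), ← zero_add (1 : ℤ),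
        ← shift_preimage_patternSet, Function.iterate_succ_apply' _ (m + 1)]
      rfl
    simp only [μ, Measure.smul_apply, Measure.finsetSum_apply, smul_eq_mul]
    set d : ℕ → ℝ≥0∞ := fun m => Measure.dirac (shift^[m + 1] ω) (patternSet I w 0) with hd
    have hd1 : ∀ m, d m ≤ 1 := fun m => prob_le_one
    have h1 : ∑ m ∈ Finset.range (N + 1), Measure.dirac (shift^[m + 1] ω) (patternSet I w 1) =
        ∑ m ∈ Finset.range (N + 1), d (m + 1) := Finset.sum_congr rfl fun m _ => hshift m
    have e1 : ∑ m ∈ Finset.range (N + 1), d (m + 1) ≤ ∑ m ∈ Finset.range (N + 1), d m + 1 := by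
      rw [Finset.sum_range_succ, Finset.sum_range_succ' d]
      gcongr
      · exact le_self_add
      · exact hd1 _
    have e2 : ∑ m ∈ Finset.range (N + 1), d m ≤ ∑ m ∈ Finset.range (N + 1), d (m + 1) + 1 := by
      rw [Finset.sum_range_succ (fun m => d (m + 1)), Finset.sum_range_succ' d]
      gcongr
      · exact le_self_add
      · exact hd1 _
    rcases hij with ⟨rfl, rfl⟩ | ⟨rfl, rfl⟩
    · rw [h1, ← mul_add_one]
      gcongr
    · rw [h1, ← mul_add_one]
      gcongr
  have hinv : Tendsto (fun N : ℕ => ((N + 1 : ℕ) : ℝ≥0∞)⁻¹) (hyperfilter ℕ) (nhds 0) :=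
    (ENNReal.tendsto_inv_nat_nhds_zero.comp (tendsto_add_atTop_nat 1)).mono_left hle
  have hcmp : ∀ I w (i j : ℤ), (i = 0 ∧ j = 1) ∨ (i = 1 ∧ j = 0) →
      (ν : Measure (ℤ → A)) (patternSet I w i) ≤ (ν : Measure (ℤ → A)) (patternSet I w j) := by
    intro I w i j hij
    have := le_of_tendsto_of_tendsto' (hpat I w i) ((hpat I w j).add hinv)
      fun N => htel I w N i j hij
    simpa using this
  have hcl : IsClosed (subshiftOf ω) := isClosed_closure
  have hmeas : Measurable (shift : (ℤ → A) → ℤ → A) := continuous_shift.measurable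
  refine ⟨ν, inferInstance, ?_, hmeas, ?_⟩
  · have h0 : ∀ N, (P N : Measure (ℤ → A)) (subshiftOf ω)ᶜ = 0 := fun N => by
      simp only [P, μ, ProbabilityMeasure.coe_mk, Measure.smul_apply, Measure.finsetSum_apply,
        smul_eq_mul, mul_eq_zero]
      right
      refine Finset.sum_eq_zero fun m _ => ?_
      rw [Measure.dirac_apply' _ hcl.measurableSet.compl,
        Set.indicator_of_notMem (not_not.2 (shift_iterate_mem_subshiftOf ω m))]
    have := ProbabilityMeasure.le_liminf_measure_open_of_tendsto hlim hcl.isOpen_compl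
    change _ ≤ liminf (fun N => (P N : Measure (ℤ → A)) (subshiftOf ω)ᶜ) _ at this
    simp_rw [h0] at this
    simpa using this
  · refine measure_ext_of_patternSet fun I w => ?_
    rw [Measure.map_apply hmeas (measurableSet_patternSet I w 0), shift_preimage_patternSet,
      zero_add]
    exact le_antisymm (hcmp I w 1 0 (by simp)) (hcmp I w 0 1 (by simp))

end Measure

/-! ### Holes of the partial words -/

/-- The position `j` is still undetermined before stage `k`, that is, it lies in
`s_k ℤ + holeOffset k`. For `k ≥ 1` these positions are the holes of `ω_{k-1}`. -/
def IsHole (n r : ℕ → ℕ) (k : ℕ) (j : ℤ) : Prop :=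
  (periodProd n k : ℤ) ∣ j - holeOffset n r k

lemma periodProd_succ (n : ℕ → ℕ) (k : ℕ) : periodProd n (k + 1) = periodProd n k * n k :=
  Finset.prod_range_succ _ _

lemma periodProd_dvd (n : ℕ → ℕ) {k l : ℕ} (h : k ≤ l) : periodProd n k ∣ periodProd n l :=
  Finset.prod_dvd_prod_of_subset _ _ _ (Finset.range_mono h)

lemma periodProd_pos {n : ℕ → ℕ} (hn : ∀ k, 2 ≤ n k) (k : ℕ) : 0 < periodProd n k :=
  Finset.prod_pos fun i _ => by have := hn i; omega

lemma lt_periodProd {n : ℕ → ℕ} (hn : ∀ k, 2 ≤ n k) (k : ℕ) : k < periodProd n k := by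
  induction k with
  | zero => exact periodProd_pos hn 0
  | succ k ih =>
    rw [periodProd_succ]
    nlinarith [hn k]

lemma two_mul_periodProd_le {n : ℕ → ℕ} (hn : ∀ k, 2 ≤ n k) (k : ℕ) :
    2 * periodProd n k ≤ periodProd n (k + 1) := by
  rw [periodProd_succ, mul_comm]
  exact Nat.mul_le_mul_left _ (hn k)

lemma periodProd_le {n : ℕ → ℕ} (hn : ∀ k, 2 ≤ n k) {k l : ℕ} (h : k ≤ l) :
    periodProd n k ≤ periodProd n l :=
  Nat.le_of_dvd (periodProd_pos hn l) (periodProd_dvd n h)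

lemma isHole_zero (n r : ℕ → ℕ) (j : ℤ) : IsHole n r 0 j := by
  simp [IsHole, periodProd]

lemma IsHole.of_succ {n r : ℕ → ℕ} {k : ℕ} {j : ℤ} (h : IsHole n r (k + 1) j) :
    IsHole n r k j := by
  obtain ⟨t, ht⟩ := h
  refine ⟨n k * t + r k, ?_⟩
  rw [periodProd_succ, holeOffset, Finset.sum_range_succ, ← holeOffset] at ht
  push_cast at ht
  linear_combination ht

lemma IsHole.mono {n r : ℕ → ℕ} {k l : ℕ} (hkl : k ≤ l) {j : ℤ} (h : IsHole n r l j) :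
    IsHole n r k j := by
  induction hkl with
  | refl => exact h
  | step _ ih => exact ih h.of_succ

lemma isHole_add_iff {n r : ℕ → ℕ} {k : ℕ} {j d : ℤ} (hd : (periodProd n k : ℤ) ∣ d) :
    IsHole n r k (j + d) ↔ IsHole n r k j := by
  rw [IsHole, IsHole, show j + d - holeOffset n r k = j - holeOffset n r k + d by ring,
    dvd_add_left hd]

lemma isHole_add_mul_iff {n r : ℕ → ℕ} {k : ℕ} {j t : ℤ} :
    IsHole n r k (j + periodProd n k * t) ↔ IsHole n r k j :=
  isHole_add_iff (dvd_mul_right _ _)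

lemma IsHole.dvd_sub {n r : ℕ → ℕ} {k : ℕ} {i j : ℤ} (hi : IsHole n r k i)
    (hj : IsHole n r k j) : (periodProd n k : ℤ) ∣ i - j := by
  have := Int.dvd_sub hi hj
  rwa [sub_sub_sub_cancel_right] at this

lemma IsHole.eq_of_lt {n r : ℕ → ℕ} {k : ℕ} {i j : ℤ} (hi : IsHole n r k i)
    (hj : IsHole n r k j) (h1 : i - j < periodProd n k) (h2 : j - i < periodProd n k) : i = j :=
  sub_eq_zero.1 (Int.eq_zero_of_abs_lt_dvd (hi.dvd_sub hj) (abs_sub_lt_iff.2 ⟨h1, h2⟩))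

/-- Every residue class modulo `s_k` is represented in each window of length `s_k`, in particular
that of the holes. -/
lemma exists_isHole_mem_Ico {n : ℕ → ℕ} (hn : ∀ k, 2 ≤ n k) (r : ℕ → ℕ) (k : ℕ) (q : ℤ) :
    ∃ h, IsHole n r k h ∧ q ≤ h ∧ h < q + periodProd n k := by
  have hs : (0 : ℤ) < periodProd n k := by exact_mod_cast periodProd_pos hn k
  refine ⟨q + (holeOffset n r k - q) % periodProd n k, ?_, ?_, ?_⟩
  · refine ⟨-((holeOffset n r k - q) / periodProd n k), ?_⟩
    have := Int.emod_add_mul_ediv (holeOffset n r k - q) (periodProd n k)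
    linear_combination this
  · linarith [Int.emod_nonneg (holeOffset n r k - q) hs.ne']
  · linarith [Int.emod_lt_of_pos (holeOffset n r k - q) hs]

/-- Two consecutive positions of `s_k ℤ + holeOffset k` cannot both survive stage `k`. -/
lemma IsHole.not_succ_add {n r : ℕ → ℕ} (hn : ∀ k, 2 ≤ n k) {k : ℕ} {j : ℤ}
    (h : IsHole n r (k + 1) j) : ¬ IsHole n r (k + 1) (j + periodProd n k) := by
  intro h'
  have h1 : (0 : ℤ) < periodProd n k := by exact_mod_cast periodProd_pos hn k
  have h2 : (2 : ℤ) * periodProd n k ≤ periodProd n (k + 1) := by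
    exact_mod_cast two_mul_periodProd_le hn k
  have := h.eq_of_lt h' (by linarith) (by linarith)
  linarith

/-- Each window of length `2 s_k` contains a position that is filled exactly at stage `k`. -/
lemma exists_isHole_not_succ {n : ℕ → ℕ} (hn : ∀ k, 2 ≤ n k) (r : ℕ → ℕ) (k : ℕ) (q : ℤ) :
    ∃ h, IsHole n r k h ∧ ¬ IsHole n r (k + 1) h ∧ q ≤ h ∧ h < q + 2 * periodProd n k := by
  obtain ⟨h, hh, h1, h2⟩ := exists_isHole_mem_Ico hn r k q
  have hs : (0 : ℤ) < periodProd n k := by exact_mod_cast periodProd_pos hn k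
  by_cases hk : IsHole n r (k + 1) h
  · exact ⟨_, (isHole_add_iff dvd_rfl).2 hh, hk.not_succ_add hn, by linarith, by linarith⟩
  · exact ⟨h, hh, hk, h1, by linarith⟩

lemma partialWord_eq_none_iff_isHole (a : ℕ → A) {n : ℕ → ℕ} (hn : ∀ k, 2 ≤ n k) (r : ℕ → ℕ)
    (k : ℕ) (j : ℤ) : partialWord a n r k j = none ↔ IsHole n r (k + 1) j :=
  partialWord_eq_none_iff a n r hn k j

lemma partialWord_eq_some (a : ℕ → A) {n r : ℕ → ℕ} (hn : ∀ k, 2 ≤ n k) {k : ℕ} {j : ℤ}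
    (h : IsHole n r k j) (h' : ¬ IsHole n r (k + 1) j) : partialWord a n r k j = some (a k) := by
  rw [← partialWord_eq_none_iff_isHole a hn] at h'
  cases k with
  | zero =>
    simp only [partialWord, holeWord] at h' ⊢
    split_ifs at h' ⊢ <;> simp_all
  | succ k =>
    rw [IsHole] at h
    simp only [partialWord, fill, holeWord, if_pos h] at h' ⊢
    split_ifs at h' ⊢ <;> simp_all

lemma limitWord_eq_some (a : ℕ → A) {n r : ℕ → ℕ} (hn : ∀ k, 2 ≤ n k) {k : ℕ} {j : ℤ}
    (h : IsHole n r k j) (h' : ¬ IsHole n r (k + 1) j) : limitWord a n r j = some (a k) := by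
  classical
  have hex : ∃ m, partialWord a n r m j ≠ none :=
    ⟨k, by rwa [Ne, partialWord_eq_none_iff_isHole a hn]⟩
  have hfind : Nat.find hex = k := (Nat.find_eq_iff hex).2
    ⟨by rwa [Ne, partialWord_eq_none_iff_isHole a hn], fun m hm => not_not.2
      ((partialWord_eq_none_iff_isHole a hn r m j).2 (h.mono hm))⟩
  rw [limitWord, dif_pos hex, ← partialWord_eq_some a hn h h']
  congr!

lemma limitWord_eq_none (a : ℕ → A) {n r : ℕ → ℕ} (hn : ∀ k, 2 ≤ n k) {j : ℤ}
    (h : ∀ k, IsHole n r k j) : limitWord a n r j = none := by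
  rw [limitWord, dif_neg]
  rintro ⟨k, hk⟩
  exact hk ((partialWord_eq_none_iff_isHole a hn r k j).2 (h (k + 1)))

lemma IsHole.exists_stage {n r : ℕ → ℕ} {k l : ℕ} {j : ℤ} (h : IsHole n r k j)
    (hl : ¬ IsHole n r l j) : ∃ m, k ≤ m ∧ m < l ∧ IsHole n r m j ∧ ¬ IsHole n r (m + 1) j := by
  induction l with
  | zero => exact absurd (isHole_zero n r j) hl
  | succ l ih =>
    by_cases hl' : IsHole n r l j
    · refine ⟨l, ?_, l.lt_succ_self, hl', hl⟩
      by_contra! hlk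
      exact hl (h.mono hlk)
    · obtain ⟨m, h1, h2, h3⟩ := ih hl'
      exact ⟨m, h1, h2.trans l.lt_succ_self, h3⟩

lemma sum_range_eq_of_periodic {f : ℤ → ℕ} {N : ℕ} (hf : ∀ j, f (j + N) = f j) (q : ℤ) :
    ∑ m ∈ Finset.range N, f (q + m) = ∑ m ∈ Finset.range N, f m := by
  have step : ∀ q : ℤ, ∑ m ∈ Finset.range N, f (q + 1 + m) =
      ∑ m ∈ Finset.range N, f (q + m) := fun q => by
    have h := Finset.sum_range_succ (fun m : ℕ => f (q + m)) N
    rw [Finset.sum_range_succ'] at h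
    have h0 : f (q + (0 : ℕ)) = f (q + N) := by simp [hf]
    rw [h0, add_left_inj] at h
    rw [← h]
    refine Finset.sum_congr rfl fun m _ => ?_
    push_cast
    ring_nf
  induction q using Int.induction_on with
  | zero => simp
  | succ i ih => rw [step, ih]
  | pred i ih => rw [← ih, ← step, sub_add_cancel]

namespace IsSimpleToeplitzWord

variable {a : ℕ → A} {n r : ℕ → ℕ} {ω : ℤ → A}

lemma apply_eq (hω : IsSimpleToeplitzWord a n r ω) {k : ℕ} {j : ℤ} (h : IsHole n r k j)
    (h' : ¬ IsHole n r (k + 1) j) : ω j = a k := by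
  obtain ⟨c, -, hc⟩ := hω.eq_limit
  rw [hc, limitWord_eq_some a hω.two_le h h', Option.getD_some]

lemma apply_mem_tailAlphabet (hω : IsSimpleToeplitzWord a n r ω) {k : ℕ} {j : ℤ}
    (h : IsHole n r k j) : ω j ∈ tailAlphabet a k := by
  by_cases hall : ∀ l, IsHole n r l j
  · obtain ⟨c, hc, hc'⟩ := hω.eq_limit
    rw [hc', limitWord_eq_none a hω.two_le hall, Option.getD_none]
    exact Set.mem_iInter.1 hc k
  · push Not at hall
    obtain ⟨l, hl⟩ := hall
    obtain ⟨m, hkm, -, h1, h2⟩ := IsHole.exists_stage h hl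
    rw [hω.apply_eq h1 h2]
    exact Set.mem_image_of_mem _ hkm

lemma apply_add_eq (hω : IsSimpleToeplitzWord a n r ω) {k : ℕ} {j d : ℤ}
    (h : ¬ IsHole n r k j) (hd : (periodProd n k : ℤ) ∣ d) : ω (j + d) = ω j := by
  obtain ⟨m, -, hmk, h1, h2⟩ := IsHole.exists_stage (isHole_zero n r j) h
  have hdvd : ∀ i ≤ k, (periodProd n i : ℤ) ∣ d := fun i hi =>
    (Int.natCast_dvd_natCast.2 (periodProd_dvd n hi)).trans hd
  rw [hω.apply_eq h1 h2, hω.apply_eq ((isHole_add_iff (hdvd m hmk.le)).2 h1)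
    (fun h => h2 ((isHole_add_iff (hdvd (m + 1) hmk)).1 h))]

/-! ### Unique ergodicity -/

/-- A window of length `s_k` contains the same number of occurrences of a pattern, up to those
occurrences that meet a hole of level `k`; there are at most as many of these as prescribed
letters. -/
lemma countOcc_periodProd (hω : IsSimpleToeplitzWord a n r ω) (I : Finset ℤ) (w : ℤ → A) (k : ℕ) :
    ∃ c, ∀ q, c ≤ countOcc ω I w (periodProd n k) q ∧
      countOcc ω I w (periodProd n k) q ≤ c + I.card := by
  classical
  let good : ℤ → ℕ := fun j =>
    if (∀ i ∈ I, ¬ IsHole n r k (j + i)) ∧ ω ∈ patternSet I w j then 1 else 0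
  let hole : ℤ → ℕ := fun j => if IsHole n r k j then 1 else 0
  have hiff : ∀ j, IsHole n r k (j + periodProd n k) ↔ IsHole n r k j := fun j =>
    isHole_add_iff dvd_rfl
  have hgood : ∀ j, good (j + periodProd n k) = good j := fun j => by
    have h1 : ∀ i, j + periodProd n k + i = j + i + periodProd n k := fun i => by ring
    simp only [good, mem_patternSet, h1, hiff]
    congr 1
    refine propext (and_congr_right fun hi => forall₂_congr fun i hi' => ?_)
    rw [hω.apply_add_eq (hi i hi') dvd_rfl]
  have hhole : ∀ q, ∑ m ∈ Finset.range (periodProd n k), hole (q + m) ≤ 1 := fun q => by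
    rw [Finset.sum_boole, Nat.cast_id, Finset.card_le_one]
    intro x hx y hy
    rw [Finset.mem_filter, Finset.mem_range] at hx hy
    have := hx.2.eq_of_lt hy.2 (by omega) (by omega)
    omega
  have hcount : ∀ q, countOcc ω I w (periodProd n k) q =
      ∑ m ∈ Finset.range (periodProd n k), if ω ∈ patternSet I w (q + m) then 1 else 0 := by
    intro q
    simp [countOcc]
  refine ⟨∑ m ∈ Finset.range (periodProd n k), good m, fun q => ⟨?_, ?_⟩⟩
  · rw [hcount, ← sum_range_eq_of_periodic hgood q]
    refine Finset.sum_le_sum fun m _ => ?_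
    simp only [good]
    split_ifs <;> simp_all
  · calc countOcc ω I w (periodProd n k) q
        ≤ ∑ m ∈ Finset.range (periodProd n k),
          (good (q + m) + ∑ i ∈ I, hole (q + m + i)) := by
          rw [hcount]
          refine Finset.sum_le_sum fun m _ => ?_
          split_ifs with hocc
          · by_cases hi : ∀ i ∈ I, ¬ IsHole n r k (q + m + i)
            · have : good (q + m) = 1 := if_pos ⟨hi, hocc⟩
              omega
            · push Not at hi
              obtain ⟨i, hiI, hi⟩ := hi
              have h1 : hole (q + m + i) = 1 := if_pos hi
              have := Finset.single_le_sum (f := fun i => hole (q + m + i))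
                (fun _ _ => Nat.zero_le _) hiI
              simp only [h1] at this
              omega
          · exact Nat.zero_le _
      _ ≤ ∑ m ∈ Finset.range (periodProd n k), good m + ∑ i ∈ I, 1 := by
          rw [Finset.sum_add_distrib, sum_range_eq_of_periodic hgood q, Finset.sum_comm]
          gcongr with i _
          refine le_trans (le_of_eq ?_) (hhole (q + i))
          refine Finset.sum_congr rfl fun m _ => ?_
          rw [add_right_comm]
      _ = _ := by simp

lemma isInvariantProb_unique [Finite A] [TopologicalSpace A] [DiscreteTopology A]
    [MeasurableSpace A] [BorelSpace A] (hω : IsSimpleToeplitzWord a n r ω)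
    {μ ν : Measure (ℤ → A)} (hμ : IsInvariantProb (subshiftOf ω) μ)
    (hν : IsInvariantProb (subshiftOf ω) ν) : μ = ν :=
  IsInvariantProb.unique (fun I w => ⟨I.card, fun N₀ => ⟨periodProd n N₀,
    (lt_periodProd hω.two_le N₀).le, hω.countOcc_periodProd I w N₀⟩⟩) hμ hν

end IsSimpleToeplitzWord

/-! ### The positions `K(k)` and the growth positions -/

lemma allLetters_le {a : ℕ → A} {k j : ℕ} (hj : k < j)
    (h : tailAlphabet a (k + 1) ⊆ a '' Set.Icc (k + 1) j) : allLetters a k ≤ j :=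
  Nat.sInf_le ⟨hj, (Set.image_mono Set.Icc_subset_Ici_self).antisymm h⟩

section AllLetters

variable [Finite A] (a : ℕ → A)

lemma exists_image_Icc_eq_tailAlphabet (k : ℕ) :
    ∃ j, k < j ∧ a '' Set.Icc (k + 1) j = tailAlphabet a (k + 1) := by
  have hsub : ∀ c ∈ tailAlphabet a (k + 1), ∃ i, k + 1 ≤ i ∧ a i = c := fun c hc => hc
  choose! f hf using hsub
  obtain ⟨M, hM⟩ := (Set.toFinite (f '' tailAlphabet a (k + 1))).bddAbove
  refine ⟨max M (k + 1), by omega, Set.Subset.antisymm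
    (Set.image_mono Set.Icc_subset_Ici_self) fun c hc => ?_⟩
  exact ⟨f c, ⟨(hf c hc).1, le_max_of_le_left (hM (Set.mem_image_of_mem _ hc))⟩, (hf c hc).2⟩

lemma lt_allLetters (k : ℕ) : k < allLetters a k :=
  (Nat.sInf_mem (exists_image_Icc_eq_tailAlphabet a k)).1

lemma image_Icc_allLetters (k : ℕ) :
    a '' Set.Icc (k + 1) (allLetters a k) = tailAlphabet a (k + 1) :=
  (Nat.sInf_mem (exists_image_Icc_eq_tailAlphabet a k)).2

variable {a}

lemma add_two_le_allLetters (ha : ∀ k, a k ≠ a (k + 1)) (k : ℕ) : k + 2 ≤ allLetters a k := by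
  by_contra! h
  have hK : allLetters a k = k + 1 := by have := lt_allLetters a k; omega
  have h2 : a (k + 2) ∈ a '' Set.Icc (k + 1) (allLetters a k) := by
    rw [image_Icc_allLetters]
    exact Set.mem_image_of_mem _ (by simp)
  rw [hK, Set.Icc_self, Set.image_singleton, Set.mem_singleton_iff] at h2
  exact ha (k + 1) h2.symm

/-- By minimality of `K(k)`, its letter appears there for the first time after position `k`. -/
lemma apply_allLetters_ne (ha : ∀ k, a k ≠ a (k + 1)) {k i : ℕ} (hi : k + 1 ≤ i)
    (hi' : i < allLetters a k) : a i ≠ a (allLetters a k) := by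
  intro h
  have h2 := add_two_le_allLetters ha k
  have : allLetters a k ≤ allLetters a k - 1 := by
    refine allLetters_le (by omega) ?_
    rw [← image_Icc_allLetters a k]
    rintro _ ⟨j, hj, rfl⟩
    rw [Set.mem_Icc] at hj
    by_cases hjK : j = allLetters a k
    · exact ⟨i, ⟨hi, by omega⟩, by rw [hjK, h]⟩
    · exact ⟨j, ⟨hj.1, by omega⟩, rfl⟩
  omega

lemma allLetters_mono : Monotone (allLetters a) := by
  refine monotone_nat_of_le_succ fun k => ?_
  have h2 := lt_allLetters a (k + 1)
  refine allLetters_le (by omega) ?_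
  rintro _ ⟨j, hj, rfl⟩
  rw [Set.mem_Ici] at hj
  rcases hj.eq_or_lt with rfl | hj
  · exact ⟨k + 1, ⟨le_rfl, by omega⟩, rfl⟩
  · have : a j ∈ a '' Set.Icc (k + 2) (allLetters a (k + 1)) := by
      rw [image_Icc_allLetters]
      exact ⟨j, hj, rfl⟩
    exact Set.image_mono (Set.Icc_subset_Icc_left (by omega)) this

lemma growthPos_succ_spec (i : ℕ) : growthPos a i < growthPos a (i + 1) ∧
    allLetters a (growthPos a i) < allLetters a (growthPos a (i + 1)) := by
  have : {j | growthPos a i < j ∧ allLetters a (growthPos a i) < allLetters a j}.Nonempty :=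
    ⟨allLetters a (growthPos a i), lt_allLetters a _, lt_allLetters a _⟩
  exact Nat.sInf_mem this

lemma strictMono_growthPos : StrictMono (growthPos a) :=
  strictMono_nat_of_lt_succ fun i => (growthPos_succ_spec i).1

/-- The first growth position `m ≥ k` satisfies `K(m - 1) = K(k - 1)`. -/
lemma exists_growthPos {k : ℕ} (hk : 1 ≤ k) :
    ∃ i, 1 ≤ i ∧ k ≤ growthPos a i ∧
      allLetters a (growthPos a i - 1) = allLetters a (k - 1) := by
  have hex : ∃ i, k ≤ growthPos a i := ⟨k, strictMono_growthPos.le_apply⟩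
  classical
  have h1 := Nat.find_spec hex
  have h2 : ∀ m < Nat.find hex, ¬ k ≤ growthPos a m := fun m => Nat.find_min hex
  generalize Nat.find hex = i at h1 h2
  cases i with
  | zero => simp [growthPos] at h1; omega
  | succ i =>
    have hi := h2 i i.lt_succ_self
    have hm : ∀ j, growthPos a i ≤ j → j < growthPos a (i + 1) →
        allLetters a j = allLetters a (growthPos a i) := fun j h h' => by
      refine le_antisymm ?_ (allLetters_mono h)
      rcases h.eq_or_lt with rfl | h
      · exact le_rfl
      · by_contra! hlt
        have : growthPos a (i + 1) ≤ j := Nat.sInf_le ⟨h, hlt⟩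
        omega
    exact ⟨i + 1, by omega, h1,
      by rw [hm _ (by omega) (by omega), hm (k - 1) (by omega) (by omega)]⟩

/-- Among the positions `k`, it suffices to consider the growth positions, since moving `k` up to
the next growth position only removes factors from the product. -/
lemma exists_gapProd_le_iff_growthPos {n : ℕ → ℕ} (hn : ∀ k, 2 ≤ n k) :
    (∃ k : ℕ → ℕ, (∀ t, 1 ≤ k t) ∧ Tendsto k atTop atTop ∧ ∃ C : ℕ, ∀ t, gapProd a n (k t) ≤ C) ↔
      ∃ i : ℕ → ℕ, (∀ t, 1 ≤ i t) ∧ StrictMono i ∧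
        ∃ C : ℕ, ∀ t, gapProd a n (growthPos a (i t)) ≤ C := by
  constructor
  · rintro ⟨k, hk, hlim, C, hC⟩
    choose i hi hki hK using fun t => exists_growthPos (a := a) (hk t)
    have hilim : Tendsto i atTop atTop := by
      refine tendsto_atTop.2 fun b => ?_
      filter_upwards [hlim.eventually_ge_atTop (growthPos a b)] with t ht
      exact strictMono_growthPos.le_iff_le.1 (ht.trans (hki t))
    obtain ⟨φ, -, hφ⟩ := strictMono_subseq_of_tendsto_atTop hilim
    refine ⟨i ∘ φ, fun t => hi _, hφ, C, fun t => le_trans ?_ (hC (φ t))⟩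
    have hki' := hki (φ t)
    rw [Function.comp_apply, gapProd, gapProd, hK]
    exact Finset.prod_le_prod_of_subset_of_one_le'
      (Finset.Ico_subset_Ico_left (by omega)) fun j _ _ => by have := hn j; omega
  · rintro ⟨i, hi, hmono, C, hC⟩
    refine ⟨fun t => growthPos a (i t), fun t => (hi t).trans strictMono_growthPos.le_apply,
      (strictMono_growthPos.comp hmono).tendsto_atTop, C, hC⟩

lemma periodProd_mul_gapProd (ha : ∀ k, a k ≠ a (k + 1)) (n : ℕ → ℕ) {k : ℕ} (hk : 1 ≤ k) :
    periodProd n (k + 1) * gapProd a n k = periodProd n (allLetters a (k - 1)) :=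
  Finset.prod_range_mul_prod_Ico n (by have := add_two_le_allLetters ha (k - 1); omega)

end AllLetters

namespace IsSimpleToeplitzWord

variable {a : ℕ → A} {n r : ℕ → ℕ} {ω : ℤ → A}

/-! ### Boundedness of the products implies (B) -/

/-- A pattern that meets no hole of level `k` reappears in every window of length `s_k`. -/
lemma exists_patternSet_of_forall_not_isHole (hω : IsSimpleToeplitzWord a n r ω) {k : ℕ}
    {I : Finset ℤ} {w : ℤ → A} {j : ℤ} (hj : ω ∈ patternSet I w j)
    (h : ∀ i ∈ I, ¬ IsHole n r k (j + i)) (q : ℤ) :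
    ∃ p, q ≤ p ∧ p < q + periodProd n k ∧ ω ∈ patternSet I w p := by
  have hs : (0 : ℤ) < periodProd n k := by exact_mod_cast periodProd_pos hω.two_le k
  have h1 := Int.emod_add_mul_ediv (j - q) (periodProd n k)
  refine ⟨q + (j - q) % periodProd n k, by linarith [Int.emod_nonneg (j - q) hs.ne'],
    by linarith [Int.emod_lt_of_pos (j - q) hs], fun i hi => ?_⟩
  rw [show q + (j - q) % periodProd n k + i =
    j + i + periodProd n k * (-((j - q) / periodProd n k)) by linear_combination h1,
    hω.apply_add_eq (h i hi) (dvd_mul_right _ _), hj i hi]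

/-- Every word of length `(n_k - 1) s_k` of `ω` reappears in each window of length `2 s_K`, where
`K = K(k - 1)`. -/
lemma exists_patternSet_mem_window [Finite A] (hω : IsSimpleToeplitzWord a n r ω) {k : ℕ}
    (hk : 1 ≤ k) {w : ℤ → A} {j : ℤ}
    (hj : ω ∈ patternSet (Finset.Ico 0 (((n k - 1) * periodProd n k : ℕ) : ℤ)) w j) (q : ℤ) :
    ∃ p, q ≤ p ∧ p < q + (2 * periodProd n (allLetters a (k - 1)) : ℕ) ∧
      ω ∈ patternSet (Finset.Ico 0 (((n k - 1) * periodProd n k : ℕ) : ℤ)) w p := by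
  have hn := hω.two_le
  have hK := add_two_le_allLetters hω.letter_ne (k - 1)
  set K := allLetters a (k - 1) with hKdef
  have hLs : (((n k - 1) * periodProd n k : ℕ) : ℤ) = periodProd n (k + 1) - periodProd n k := by
    rw [periodProd_succ, Nat.sub_mul, one_mul, mul_comm (periodProd n k),
      Nat.cast_sub (Nat.le_mul_of_pos_left _ (by have := hn k; omega))]
  set L : ℤ := (((n k - 1) * periodProd n k : ℕ) : ℤ) with hL
  have hs : (0 : ℤ) < periodProd n k := by exact_mod_cast periodProd_pos hn k
  have hsK : (periodProd n (k + 1) : ℤ) ≤ periodProd n K := by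
    exact_mod_cast periodProd_le hn (by omega)
  have hnohole : ∀ {j : ℤ}, ω ∈ patternSet (Finset.Ico 0 L) w j →
      (∀ i ∈ Finset.Ico 0 L, ¬ IsHole n r (k + 1) (j + i)) →
      ∃ p, q ≤ p ∧ p < q + (2 * periodProd n K : ℕ) ∧ ω ∈ patternSet (Finset.Ico 0 L) w p := by
    intro j hj h
    obtain ⟨p, h1, h2, h3⟩ := hω.exists_patternSet_of_forall_not_isHole hj h q
    exact ⟨p, h1, by push_cast; linarith, h3⟩
  by_cases hh : ∀ i ∈ Finset.Ico 0 L, ¬ IsHole n r (k + 1) (j + i)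
  · exact hnohole hj hh
  push Not at hh
  obtain ⟨d, hd, hhole⟩ := hh
  rw [Finset.mem_Ico] at hd
  -- The word is shorter than `s_{k+1}`, so `j + d` is the only hole of level `k + 1` that it meets.
  have huniq : ∀ i ∈ Finset.Ico 0 L, IsHole n r (k + 1) (j + i) → i = d := fun i hi h => by
    rw [Finset.mem_Ico] at hi
    have := h.eq_of_lt hhole (by linarith) (by linarith)
    linarith
  -- The letter in this hole is one of `a_k, …, a_K`.
  have hmem : ω (j + d) ∈ a '' Set.Icc k K := by
    have h1 : tailAlphabet a (k - 1 + 1) = a '' Set.Icc (k - 1 + 1) K :=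
      (image_Icc_allLetters a (k - 1)).symm
    rw [Nat.sub_add_cancel hk] at h1
    rw [← h1]
    exact hω.apply_mem_tailAlphabet hhole.of_succ
  obtain ⟨i, hi, hia⟩ := hmem
  rw [Set.mem_Icc] at hi
  rcases hi.1.eq_or_lt with rfl | hik
  -- If the letter is `a_k`, the word is `s_k`-periodic and fits between two holes.
  · obtain ⟨t, ht⟩ : ∃ t : ℤ, 0 < j + periodProd n k * t - (j + d) ∧
        j + periodProd n k * t - (j + d) ≤ periodProd n k := by
      refine ⟨d / periodProd n k + 1, ?_, ?_⟩
      · linarith [Int.lt_mul_ediv_self_add (x := d) hs]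
      · linarith [Int.mul_ediv_self_le (x := d) hs.ne']
    refine hnohole (j := j + periodProd n k * t) (fun m hm => ?_) fun m hm hm' => ?_
    · rw [← hj m hm, add_right_comm]
      by_cases hm0 : IsHole n r k (j + m)
      · have hlast : ∀ m' ∈ Finset.Ico 0 L, IsHole n r k (j + m') → ω (j + m') = a k := by
          intro m' hm' h
          by_cases h' : IsHole n r (k + 1) (j + m')
          · rw [huniq m' hm' h', hia]
          · exact hω.apply_eq h h'
        rw [hlast m hm hm0, hω.apply_eq (isHole_add_mul_iff.2 hm0)]
        intro h'
        rw [Finset.mem_Ico] at hm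
        rw [add_right_comm] at h'
        have := h'.eq_of_lt hhole (by linarith) (by linarith)
        linarith
      · exact hω.apply_add_eq hm0 (dvd_mul_right _ _)
    · rw [Finset.mem_Ico] at hm
      have := hm'.eq_of_lt hhole (by linarith) (by linarith)
      linarith
  -- If the letter is `a_i` with `i > k`, move the hole to a position filled at stage `i`.
  · obtain ⟨h, h1, h2, h3, h4⟩ := exists_isHole_not_succ hn r i (q + d)
    have hle : (periodProd n i : ℤ) ≤ periodProd n K := by
      exact_mod_cast periodProd_le hn hi.2
    refine ⟨h - d, by linarith, by push_cast; linarith, fun m hm => ?_⟩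
    rw [← hj m hm]
    by_cases hmd : m = d
    · rw [hmd, sub_add_cancel, hω.apply_eq h1 h2, hia]
    · rw [show h - d + m = j + m + (h - (j + d)) by ring]
      exact hω.apply_add_eq (fun h' => hmd (huniq m hm h')) ((h1.mono hik).dvd_sub hhole)

section Measure

variable [Finite A] [TopologicalSpace A] [DiscreteTopology A] [MeasurableSpace A] [BorelSpace A]

lemma le_mul_minFreq (hω : IsSimpleToeplitzWord a n r ω) {ν : Measure (ℤ → A)}
    (hν : IsInvariantProb (subshiftOf ω) ν) {k : ℕ} (hk : 1 ≤ k) :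
    (4 * (gapProd a n k : ℝ≥0∞))⁻¹ ≤ (((n k - 1) * periodProd n k : ℕ) : ℝ≥0∞) *
      minFreq (subshiftOf ω) ν ((n k - 1) * periodProd n k) := by
  set K := allLetters a (k - 1) with hK
  set L := (n k - 1) * periodProd n k with hL
  have hn := hω.two_le
  have hpos : 0 < 2 * periodProd n K := Nat.mul_pos two_pos (periodProd_pos hn K)
  have hfreq : ((2 * periodProd n K : ℕ) : ℝ≥0∞)⁻¹ ≤ minFreq (subshiftOf ω) ν L := by
    refine le_iInf₂ fun u hu => ?_
    obtain ⟨q, hq⟩ := mem_words_subshiftOf_iff.1 hu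
    rw [cyl_eq_patternSet hq, measure_patternSet_eq hν]
    have hq' := hq
    rw [cyl_eq_patternSet hq] at hq'
    have h1 := le_mul_measure_patternSet hν (N := 2 * periodProd n K) (c := 1)
      (I := Finset.Ico 0 (L : ℤ)) (w := fun i => ω (q + i)) fun q' => by
        obtain ⟨p, hp1, hp2, hp⟩ := hω.exists_patternSet_mem_window hk hq' q'
        classical
        rw [countOcc, Nat.one_le_iff_ne_zero, ← Nat.pos_iff_ne_zero, Finset.card_pos]
        refine ⟨(p - q').toNat, ?_⟩
        rw [Finset.mem_filter, Finset.mem_range]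
        have hp3 : ((p - q').toNat : ℤ) = p - q' := Int.toNat_of_nonneg (by linarith)
        refine ⟨by rw [← hK] at hp2; omega, ?_⟩
        rwa [hp3, add_sub_cancel]
    rw [← one_div]
    exact ENNReal.div_le_of_le_mul' (by exact_mod_cast h1)
  have hgap : 4 * gapProd a n k * L ≥ 2 * periodProd n K := by
    rw [hK, ← periodProd_mul_gapProd hω.letter_ne n hk, periodProd_succ, hL]
    have h2 : n k ≤ 2 * (n k - 1) := by have := hn k; omega
    calc 2 * (periodProd n k * n k * gapProd a n k)
        ≤ 2 * (periodProd n k * (2 * (n k - 1)) * gapProd a n k) := by gcongr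
      _ = _ := by ring
  have hKpos : ((2 * periodProd n K : ℕ) : ℝ≥0∞) ≠ 0 := by exact_mod_cast hpos.ne'
  refine le_trans ?_ (mul_le_mul_right hfreq _)
  rw [← div_eq_mul_inv, ENNReal.le_div_iff_mul_le (Or.inl hKpos)
    (Or.inl (ENNReal.natCast_ne_top _)), mul_comm, ← div_eq_mul_inv]
  refine ENNReal.div_le_of_le_mul ?_
  rw [mul_comm (L : ℝ≥0∞)]
  exact_mod_cast hgap

lemma boshernitzan_of_gapProd_le (hω : IsSimpleToeplitzWord a n r ω)
    (h : ∃ k : ℕ → ℕ, (∀ t, 1 ≤ k t) ∧ Tendsto k atTop atTop ∧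
      ∃ C : ℕ, ∀ t, gapProd a n (k t) ≤ C) : Boshernitzan (subshiftOf ω) := by
  obtain ⟨k, hk, hlim, C, hC⟩ := h
  obtain ⟨ν, hν⟩ := exists_isInvariantProb ω
  refine ⟨ν, hν, fun ν' hν' => hω.isInvariantProb_unique hν' hν, ?_⟩
  have hpos : 0 < (4 * (C : ℝ≥0∞))⁻¹ :=
    ENNReal.inv_pos.2 (ENNReal.mul_ne_top (by simp) (ENNReal.natCast_ne_top _))
  refine hpos.trans_le (le_limsup_of_frequently_le (frequently_atTop.2 fun N => ?_))
  obtain ⟨t, ht⟩ := (hlim.eventually_ge_atTop N).exists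
  refine ⟨(n (k t) - 1) * periodProd n (k t), ?_, ?_⟩
  · have h1 := lt_periodProd hω.two_le (k t)
    have h2 := hω.two_le (k t)
    exact (ht.trans h1.le).trans (Nat.le_mul_of_pos_left _ (by omega))
  · refine le_trans ?_ (hω.le_mul_minFreq hν (hk t))
    gcongr
    exact hC t

end Measure

/-! ### (B) implies boundedness of the products -/

/-- A copy of the block of length `s_{k+1} - 1` to the right of a level `k + 1` hole is aligned with
the holes of level `k`. Alignment with level `k + 1` may fail, since the letter `a_k` can reappear
in a hole of that level. -/
lemma isHole_of_forall_eq_right (hω : IsSimpleToeplitzWord a n r ω) {k : ℕ} {c q : ℤ}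
    (hc : IsHole n r (k + 1) c)
    (h : ∀ i : ℤ, 0 < i → i < periodProd n (k + 1) → ω (q + i) = ω (c + i)) :
    IsHole n r k q := by
  induction k with
  | zero => exact isHole_zero n r q
  | succ k ih =>
    have h1 : (0 : ℤ) < periodProd n (k + 1) := by
      exact_mod_cast periodProd_pos hω.two_le (k + 1)
    have h2 : (2 : ℤ) * periodProd n (k + 1) ≤ periodProd n (k + 2) := by
      exact_mod_cast two_mul_periodProd_le hω.two_le (k + 1)
    have hq : IsHole n r k q := ih hc.of_succ fun i hi hi' => h i hi (by linarith)
    by_contra hq'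
    -- The next letter at level `k + 1` right of `c` is `a_{k+1}`, whereas it is `a_k` for `q`.
    have e1 : ω (c + periodProd n (k + 1)) = a (k + 1) :=
      hω.apply_eq ((isHole_add_iff dvd_rfl).2 hc.of_succ) (hc.not_succ_add hω.two_le)
    have e2 : ω (q + periodProd n (k + 1)) = a k :=
      hω.apply_eq
        ((isHole_add_iff (Int.natCast_dvd_natCast.2 (periodProd_dvd n k.le_succ))).2 hq)
        fun h' => hq' ((isHole_add_iff dvd_rfl).1 h')
    rw [h _ h1 (by linarith), e1] at e2
    exact hω.letter_ne k e2.symm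

/-- A copy of the blocks of length `s_{k+1} - 1` on both sides of a position filled at stage `K`,
together with the letter in between, determines the position modulo `s_K`, provided that the letter
`a_K` does not occur among `a_{k+1}, …, a_{K-1}`. -/
lemma isHole_of_forall_eq (hω : IsSimpleToeplitzWord a n r ω) {k K : ℕ} (hkK : k + 1 < K)
    (hK : ∀ i, k + 1 ≤ i → i < K → a i ≠ a K) {c q : ℤ} (hc : IsHole n r K c)
    (hc' : ¬ IsHole n r (K + 1) c)
    (h : ∀ i : ℤ, -periodProd n (k + 1) < i → i < periodProd n (k + 1) → ω (q + i) = ω (c + i)) :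
    IsHole n r K q := by
  have hn := hω.two_le
  have h0 : (0 : ℤ) < periodProd n k := by exact_mod_cast periodProd_pos hn k
  have hck : IsHole n r (k + 1) c := hc.mono hkK.le
  have hle : (2 : ℤ) * periodProd n k ≤ periodProd n (k + 1) := by
    exact_mod_cast two_mul_periodProd_le hn k
  have hq : IsHole n r k q :=
    hω.isHole_of_forall_eq_right hck fun i hi hi' => h i (by linarith) hi'
  have hqc : ω q = a K := by
    have := h 0 (by linarith) (by linarith)
    rwa [add_zero, add_zero, hω.apply_eq hc hc'] at this
  have hq1 : IsHole n r (k + 1) q := by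
    by_contra hq'
    have hak : a k = a K := by rw [← hqc, hω.apply_eq hq hq']
    obtain ⟨p, hp, hp1, hp2⟩ := exists_isHole_mem_Ico hn r (k + 1) q
    have hpq : p ≠ q := fun e => hq' (e ▸ hp)
    have hpq' : q < p := lt_of_le_of_ne hp1 hpq.symm
    -- All letters of level `k` in the copy are `a_k`, in contrast to two consecutive letters of
    -- level `k + 1`, one of which is `a_{k+1}`.
    have hcopy : ∀ x : ℤ, IsHole n r k x → x ≠ q → q - periodProd n (k + 1) < x →
        x < q + periodProd n (k + 1) → ω x = a k := by
      intro x hx hxq h1 h2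
      have e := h (x - q) (by linarith) (by linarith)
      rw [add_sub_cancel] at e
      rw [e]
      refine hω.apply_eq ((isHole_add_iff (hx.dvd_sub hq)).2 hck.of_succ) fun h' => hxq ?_
      have := h'.eq_of_lt hck (by linarith) (by linarith)
      linarith
    have hp' : IsHole n r (k + 1) (p - periodProd n (k + 1)) := by
      have := isHole_add_iff (n := n) (r := r) (k := k + 1) (j := p - periodProd n (k + 1))
        (d := periodProd n (k + 1)) dvd_rfl
      rw [sub_add_cancel] at this
      exact this.1 hp
    have e1 := hcopy p hp.of_succ hpq (by linarith) hp2
    have e2 := hcopy _ hp'.of_succ (by intro e; linarith) (by linarith) (by linarith)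
    by_cases hs : IsHole n r (k + 2) (p - periodProd n (k + 1))
    · have := hs.not_succ_add hn
      rw [sub_add_cancel] at this
      exact hω.letter_ne k (by rw [← e1, hω.apply_eq hp this])
    · exact hω.letter_ne k (by rw [← e2, hω.apply_eq hp' hs])
  by_contra hq'
  obtain ⟨m, h1, h2, h3, h4⟩ := IsHole.exists_stage hq1 hq'
  exact hK m h1 h2 (by rw [← hqc, hω.apply_eq h3 h4])

section Measure

variable [Finite A] [TopologicalSpace A] [DiscreteTopology A] [MeasurableSpace A] [BorelSpace A]

/-- For `L ≥ 2 s_k - 1` there is a word of length `L` of frequency at most `1 / s_K`, where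
`K = K(k - 1)`: any word that contains `a_K` between two complete blocks of level `k`. -/
lemma periodProd_mul_minFreq_le (hω : IsSimpleToeplitzWord a n r ω) {ν : Measure (ℤ → A)}
    (hν : IsInvariantProb (subshiftOf ω) ν) {k L : ℕ} (hk : 1 ≤ k)
    (hL : 2 * periodProd n k ≤ L + 1) :
    periodProd n (allLetters a (k - 1)) * minFreq (subshiftOf ω) ν L ≤ 1 := by
  obtain ⟨k, rfl⟩ := Nat.exists_eq_add_of_le' hk
  rw [Nat.add_sub_cancel]
  set K := allLetters a k with hKdef
  have hK := add_two_le_allLetters hω.letter_ne k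
  obtain ⟨c, hc, hc', -, -⟩ := exists_isHole_not_succ hω.two_le r K 0
  set s := (periodProd n (k + 1) : ℤ) with hs
  let u : Fin L → A := fun i => ω (c - s + 1 + (i : ℕ))
  have hu : ω ∈ cyl u (c - s + 1) := fun i => rfl
  have hle : minFreq (subshiftOf ω) ν L ≤ ν (cyl u 1) :=
    iInf₂_le u (mem_words_subshiftOf_iff.2 ⟨_, hu⟩)
  refine (mul_le_mul_right hle _).trans ?_
  rw [cyl_eq_patternSet hu, measure_patternSet_eq hν]
  refine (mul_measure_patternSet_le hν (c := 1) fun q => ?_).trans_eq Nat.cast_one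
  have hocc : ∀ x : ℤ,
      ω ∈ patternSet (Finset.Ico 0 (L : ℤ)) (fun i => ω (c - s + 1 + i)) x →
      IsHole n r K (x + s - 1) := by
    intro x hx
    refine hω.isHole_of_forall_eq (by omega)
      (fun i hi hi' => apply_allLetters_ne hω.letter_ne hi hi') hc hc' fun i h1 h2 => ?_
    have := hx (i + s - 1) (Finset.mem_Ico.2 ⟨by omega, by omega⟩)
    rw [show x + s - 1 + i = x + (i + s - 1) by ring, this]
    ring_nf
  classical
  rw [countOcc, Finset.card_le_one]
  intro x hx y hy
  rw [Finset.mem_filter, Finset.mem_range] at hx hy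
  have := (hocc _ hx.2).eq_of_lt (hocc _ hy.2) (by omega) (by omega)
  omega

lemma exists_gapProd_le_of_boshernitzan (hω : IsSimpleToeplitzWord a n r ω)
    (h : Boshernitzan (subshiftOf ω)) :
    ∃ k : ℕ → ℕ, (∀ t, 1 ≤ k t) ∧ Tendsto k atTop atTop ∧
      ∃ C : ℕ, ∀ t, gapProd a n (k t) ≤ C := by
  obtain ⟨ν, hν, -, hpos⟩ := h
  by_contra hcon
  -- Otherwise the products tend to infinity.
  have hgap : ∀ C : ℕ, ∃ k₀, 1 ≤ k₀ ∧ ∀ k ≥ k₀, C < gapProd a n k := by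
    intro C
    by_contra! hC
    choose k hk1 hk2 using fun t : ℕ => hC (t + 1) (by omega)
    exact hcon ⟨k, fun t => by have := hk1 t; omega,
      tendsto_atTop_mono (fun t => (Nat.le_succ t).trans (hk1 t)) tendsto_id, C, hk2⟩
  have hn := hω.two_le
  have hbound : ∀ C : ℕ, 0 < C → ∀ᶠ L : ℕ in atTop,
      (L : ℝ≥0∞) * minFreq (subshiftOf ω) ν L ≤ 2 / C := by
    intro C hC0
    obtain ⟨k₀, hk₀, hC⟩ := hgap C
    filter_upwards [eventually_ge_atTop (2 * periodProd n k₀)] with L hL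
    classical
    -- Choose the level `k` with `2 s_k ≤ L + 1 < 2 s_{k+1}`.
    have hb : ∀ m, 2 * periodProd n m ≤ L + 1 → m ≤ L := fun m hm => by
      have := lt_periodProd hn m
      omega
    let k := Nat.findGreatest (fun m => 2 * periodProd n m ≤ L + 1) L
    have hk : k₀ ≤ k := Nat.le_findGreatest (hb k₀ (by omega)) (by omega)
    have hk1 : 2 * periodProd n k ≤ L + 1 :=
      Nat.findGreatest_spec (P := fun m => 2 * periodProd n m ≤ L + 1) (hb k₀ (by omega))
        (by omega)
    have hk2 : L + 1 < 2 * periodProd n (k + 1) := by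
      by_contra! h'
      exact Nat.findGreatest_is_greatest (Nat.lt_succ_self k) (hb _ h') h'
    have hfreq := hω.periodProd_mul_minFreq_le hν (hk₀.trans hk) hk1
    rw [← periodProd_mul_gapProd hω.letter_ne n (hk₀.trans hk)] at hfreq
    have hC' : (C : ℝ≥0∞) ≠ 0 := by exact_mod_cast hC0.ne'
    rw [ENNReal.le_div_iff_mul_le (Or.inl hC') (Or.inl (ENNReal.natCast_ne_top _))]
    have hnat : L * C ≤ 2 * (periodProd n (k + 1) * gapProd a n k) := by
      rw [← mul_assoc]
      exact Nat.mul_le_mul (by omega) (hC k hk).le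
    calc (L : ℝ≥0∞) * minFreq (subshiftOf ω) ν L * C
        = ((L * C : ℕ) : ℝ≥0∞) * minFreq (subshiftOf ω) ν L := by push_cast; ring
      _ ≤ ((2 * (periodProd n (k + 1) * gapProd a n k) : ℕ) : ℝ≥0∞) *
          minFreq (subshiftOf ω) ν L := by gcongr
      _ = 2 * (((periodProd n (k + 1) * gapProd a n k : ℕ) : ℝ≥0∞) *
          minFreq (subshiftOf ω) ν L) := by push_cast; ring
      _ ≤ 2 * 1 := by gcongr
      _ = 2 := mul_one 2
  have hzero : limsup (fun L : ℕ => (L : ℝ≥0∞) * minFreq (subshiftOf ω) ν L) atTop ≤ 0 := by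
    have hlim : Tendsto (fun C : ℕ => (2 : ℝ≥0∞) / C) atTop (nhds 0) :=
      ENNReal.Tendsto.const_div ENNReal.tendsto_nat_nhds_top (Or.inr (by simp))
        |>.trans_eq (by simp)
    refine ge_of_tendsto hlim ?_
    filter_upwards [eventually_gt_atTop 0] with C hC
    exact limsup_le_of_le (by isBoundedDefault) (hbound C hC)
  exact absurd hpos hzero.not_gt

end Measure

end IsSimpleToeplitzWord

end SimpleToeplitz

theorem mainTheorem10 {A : Type*} [Finite A] [TopologicalSpace A] [DiscreteTopology A]
    [MeasurableSpace A] [BorelSpace A] (a : ℕ → A) (n r : ℕ → ℕ) (ω : ℤ → A)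
    (hω : SimpleToeplitz.IsSimpleToeplitzWord a n r ω) :
    (SimpleToeplitz.Boshernitzan (SimpleToeplitz.subshiftOf ω) ↔
      ∃ k : ℕ → ℕ, (∀ t, 1 ≤ k t) ∧ Tendsto k atTop atTop ∧
        ∃ C : ℕ, ∀ t, SimpleToeplitz.gapProd a n (k t) ≤ C) ∧
    ((∃ k : ℕ → ℕ, (∀ t, 1 ≤ k t) ∧ Tendsto k atTop atTop ∧
        ∃ C : ℕ, ∀ t, SimpleToeplitz.gapProd a n (k t) ≤ C) ↔
      ∃ i : ℕ → ℕ, (∀ t, 1 ≤ i t) ∧ StrictMono i ∧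
        ∃ C : ℕ, ∀ t, SimpleToeplitz.gapProd a n (SimpleToeplitz.growthPos a (i t)) ≤ C) :=
  ⟨⟨hω.exists_gapProd_le_of_boshernitzan, hω.boshernitzan_of_gapProd_le⟩,
    SimpleToeplitz.exists_gapProd_le_iff_growthPos hω.two_le⟩
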